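/- For an integer $a$ and a prime $p$, let $\left(\frac{a}{p}\right)$ denote the Kronecker symbol: the Legendre symbol if $p$ is odd, and, for $p=2$, the value $0$ if $a$ is even, $1$ if $a\equiv\pm1 \pmod 8$, and $-1$ if $a\equiv\pm3\pmod 8$. Let $\nu_p(N)$ be the exponent of the prime $p$ in the factorization of $N$, and let $\phi$ be Euler's totient function. For every positive integer $N$ define \[ K(N) = \prod_{p\nmid N}\left(1-\frac{\left(\frac{N-1}{p}\right)^2 p+1}{(p-1)^2(p+1)}\right)\prod_{p\mid N}\left(1-\frac{1}{p^{\nu_p(N)}(p-1)}\right), \qquad K^*(N)=K(N)\,\frac{N}{\phi(N)}, \] where the products run over primes $p$. A distribution function is a nondecreasing, right-continuous function $D\colon\mathbb{R}\to[0,1]$ with $\lim_{u\to-\infty}D(u)=0$ and $\lim_{u\to\infty}D(u)=1$. Theorem. There exists a distribution function $D$ such that, at every point $u$ at which $D$ is continuous, \[ D(u)=\lim_{x\to\infty}\frac1x\,\#\{N\le x : K^*(N)\le u\}, \] where $N$ ranges over the positive integers and $x$ tends to infinity through the real numbers. -/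

import Mathlib

open Filter Topology

/-- The Kronecker symbol `(a / p)` for an integer `a` and a prime `p`: for odd `p` it is the
Legendre (equivalently Jacobi) symbol, and `(a / 2)` is `0` for even `a`, `1` for `a ≡ ±1 (mod 8)`
and `-1` for `a ≡ ±3 (mod 8)`. -/
def kroneckerAtPrime (a : ℤ) (p : ℕ) : ℤ :=
  if p = 2 then ZMod.χ₈ (a : ZMod 8) else jacobiSym a p

/-- The local factor of `K(N)` at a prime `p` not dividing `N`. -/
noncomputable def localFactor (N p : ℕ) : ℝ :=
  1 - ((kroneckerAtPrime ((N : ℤ) - 1) p : ℝ) ^ 2 * p + 1) / (((p : ℝ) - 1) ^ 2 * ((p : ℝ) + 1))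

/-- `K(N)`, for a positive integer `N`. The first product runs over all primes not dividing `N`;
it is infinite, and it converges unconditionally (`multipliable_localFactor` below). -/
noncomputable def K (N : ℕ) : ℝ :=
  (∏' p : {p : ℕ // p.Prime ∧ ¬ p ∣ N}, localFactor N p) *
    ∏ p ∈ N.primeFactors, (1 - 1 / ((p : ℝ) ^ padicValNat p N * ((p : ℝ) - 1)))

/-- `K*(N) = K(N) N / φ(N)`, for a positive integer `N`. -/
noncomputable def Kstar (N : ℕ) : ℝ :=
  K N * N / (Nat.totient N : ℝ)

/-- A distribution function: a nondecreasing, right-continuous function `D : ℝ → [0, 1]` that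
tends to `0` at `-∞` and to `1` at `+∞`. -/
structure IsDistributionFunction (D : ℝ → ℝ) : Prop where
  mem_Icc : ∀ u, D u ∈ Set.Icc (0 : ℝ) 1
  monotone : Monotone D
  right_continuous : ∀ u, ContinuousWithinAt D (Set.Ici u) u
  tendsto_atBot : Tendsto D atBot (𝓝 0)
  tendsto_atTop : Tendsto D atTop (𝓝 1)

theorem kroneckerAtPrime_sq_le_one (a : ℤ) (p : ℕ) : kroneckerAtPrime a p ^ 2 ≤ 1 := by
  unfold kroneckerAtPrime
  split_ifs
  · rcases ZMod.isQuadratic_χ₈ (a : ZMod 8) with h | h | h <;> simp [h]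
  · rcases jacobiSym.trichotomy a p with h | h | h <;> simp [h]

/-- The infinite product in the definition of `K` converges, so its value is not a default. -/
theorem multipliable_localFactor (N : ℕ) :
    Multipliable fun p : {p : ℕ // p.Prime ∧ ¬ p ∣ N} => localFactor N p := by
  have hs : Summable fun p : {p : ℕ // p.Prime ∧ ¬ p ∣ N} => 4 * (1 / ((p : ℕ) : ℝ) ^ 2) :=
    ((Real.summable_one_div_nat_pow.2 one_lt_two).mul_left 4).comp_injective
      Subtype.val_injective
  have key : Summable fun p : {p : ℕ // p.Prime ∧ ¬ p ∣ N} =>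
      ‖-(((kroneckerAtPrime ((N : ℤ) - 1) p : ℝ) ^ 2 * (p : ℕ) + 1) /
        ((((p : ℕ) : ℝ) - 1) ^ 2 * (((p : ℕ) : ℝ) + 1)))‖ := by
    refine Summable.of_nonneg_of_le (fun _ => norm_nonneg _) (fun p => ?_) hs
    have hp : (2 : ℝ) ≤ ((p : ℕ) : ℝ) := by exact_mod_cast p.2.1.two_le
    have hk0 := sq_nonneg (kroneckerAtPrime ((N : ℤ) - 1) p : ℝ)
    have hk : ((kroneckerAtPrime ((N : ℤ) - 1) p : ℝ)) ^ 2 ≤ 1 := by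
      exact_mod_cast kroneckerAtPrime_sq_le_one _ _
    generalize ((p : ℕ) : ℝ) = q at hp
    generalize ((kroneckerAtPrime ((N : ℤ) - 1) p : ℝ)) ^ 2 = k at hk hk0
    have hq : 0 < (q - 1) ^ 2 * (q + 1) := by
      have : 0 < q - 1 := by linarith
      positivity
    rw [norm_neg, Real.norm_of_nonneg (by positivity), mul_one_div,
      div_le_div_iff₀ hq (by positivity)]
    have h1 : k * q + 1 ≤ q + 1 := by nlinarith
    have h2 : q ^ 2 ≤ 4 * (q - 1) ^ 2 := by nlinarith
    calc (k * q + 1) * q ^ 2 ≤ (q + 1) * q ^ 2 := by gcongr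
      _ ≤ (q + 1) * (4 * (q - 1) ^ 2) := by gcongr
      _ = 4 * ((q - 1) ^ 2 * (q + 1)) := by ring
  simpa [localFactor, sub_eq_add_neg] using multipliable_one_add_of_summable key

/-! `log K*(N)` is a sum over primes of local terms (`Kstar_eq_exp_tsum`). The term at `p` is
`O(1/p^2)`, except on the multiples of `p`, where it is `O(1/p)`; these have density `1/p`, so its
mean absolute value is at most `12/p^2`. It depends only on `N mod p^k` outside the sparse multiples
of `p^k`, hence is a limit in mean of periodic functions, and so is the sum over `p`, by summability
of `12/p^2`.

Such functions have mean values, and so do their Lipschitz images. A ramp falling from 1 at `log u`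
to 0 at `log v` lies between the indicators of `K* ≤ u` and `K* ≤ v`, so its mean value separates
the upper frequency at `u` from the lower one at `v`. Positivity of `K*` and a first-moment bound on
`log K*` give tightness, and a general criterion produces `D`. -/

/-! ### Limiting distributions from separation and tightness -/

/-- A family of empirical distribution functions whose upper limit at `u` never exceeds its lower
limit at any `v > u`, and which is tight, has a limiting distribution. -/
theorem exists_isDistributionFunction_of_separated {ι : Type*} {l : Filter ι} [l.NeBot]
    {a : ℝ → ι → ℝ} (ha0 : ∀ u x, 0 ≤ a u x) (ha1 : ∀ u x, a u x ≤ 1)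
    (hmono : ∀ x, Monotone fun u => a u x)
    (hsep : ∀ u v, u < v → ∃ m : ℝ, ∀ ε > 0, ∀ᶠ x in l, a u x ≤ m + ε ∧ m - ε ≤ a v x)
    (hbot : ∀ ε > 0, ∃ u, ∀ᶠ x in l, a u x ≤ ε)
    (htop : ∀ ε > 0, ∃ u, ∀ᶠ x in l, 1 - ε ≤ a u x) :
    ∃ D : ℝ → ℝ, IsDistributionFunction D ∧
      ∀ u : ℝ, ContinuousAt D u → Tendsto (a u) l (𝓝 (D u)) := by
  have hbdd (u : ℝ) : l.IsBoundedUnder (· ≤ ·) (a u) := isBoundedUnder_of ⟨1, ha1 u⟩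
  have hcobdd (u : ℝ) : l.IsCoboundedUnder (· ≤ ·) (a u) :=
    (isBoundedUnder_of ⟨0, ha0 u⟩ : l.IsBoundedUnder (· ≥ ·) (a u)).isCoboundedUnder_flip
  set F : ℝ → ℝ := fun u => limsup (a u) l with hF
  have hFle {u c : ℝ} (h : ∀ᶠ x in l, a u x ≤ c) : F u ≤ c := limsup_le_of_le (hcobdd u) h
  have hleF {u c : ℝ} (h : ∀ᶠ x in l, c ≤ a u x) : c ≤ F u :=
    le_limsup_of_frequently_le h.frequently (hbdd u)
  have hFmono : Monotone F := fun u v huv =>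
    limsup_le_limsup (Eventually.of_forall fun x => hmono x huv) (hcobdd u) (hbdd v)
  have hF0 (u : ℝ) : 0 ≤ F u := hleF (Eventually.of_forall (ha0 u))
  have hF1 (u : ℝ) : F u ≤ 1 := hFle (Eventually.of_forall (ha1 u))
  -- The upper limit `F` need not be right-continuous; its right limit is.
  set D : ℝ → ℝ := fun u => hFmono.stieltjesFunction u with hD
  have hFD (u : ℝ) : F u ≤ D u := hFmono.le_rightLim le_rfl
  have hDF {u v : ℝ} (h : u < v) : D u ≤ F v := hFmono.rightLim_le h
  have hDmono : Monotone D := hFmono.stieltjesFunction.mono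
  have hD0 (u : ℝ) : 0 ≤ D u := (hF0 u).trans (hFD u)
  have hD1 (u : ℝ) : D u ≤ 1 := (hDF (lt_add_one u)).trans (hF1 _)
  refine ⟨D, ⟨fun u => ⟨hD0 u, hD1 u⟩, hDmono, hFmono.stieltjesFunction.right_continuous, ?_, ?_⟩,
    ?_⟩
  · refine tendsto_order.2 ⟨fun c hc => Eventually.of_forall fun u => hc.trans_le (hD0 u),
      fun c hc => ?_⟩
    obtain ⟨u, hu⟩ := hbot (c / 2) (by positivity)
    filter_upwards [eventually_lt_atBot u] with w hw
    have := (hDF hw).trans (hFle hu)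
    linarith
  · refine tendsto_order.2 ⟨fun c hc => ?_,
      fun c hc => Eventually.of_forall fun u => (hD1 u).trans_lt hc⟩
    obtain ⟨u, hu⟩ := htop ((1 - c) / 2) (by linarith)
    filter_upwards [eventually_ge_atTop u] with w hw
    have := ((hleF hu).trans (hFD u)).trans (hDmono hw)
    linarith
  · intro u hu
    refine tendsto_order.2 ⟨fun c hc => ?_, fun c hc => ?_⟩
    -- Left continuity gives `w < v < u` with `c < D w ≤ F v ≤ m`, and separation puts `a u x`
    -- eventually above `m - ε`.
    · have h1 : ∀ᶠ w in 𝓝[<] u, c < D w :=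
        (hu.tendsto.mono_left nhdsWithin_le_nhds).eventually (lt_mem_nhds hc)
      obtain ⟨w, hcw, hwu⟩ := (h1.and self_mem_nhdsWithin).exists
      obtain ⟨v, hwv, hvu⟩ := exists_between (show w < u from hwu)
      obtain ⟨m, hm⟩ := hsep v u hvu
      have hvm : F v ≤ m := le_of_forall_pos_le_add fun ε hε =>
        hFle ((hm ε hε).mono fun x hx => hx.1)
      have hcm : c < m := hcw.trans_le ((hDF hwv).trans hvm)
      filter_upwards [hm ((m - c) / 2) (by linarith)] with x hx
      linarith [hx.2]
    · exact eventually_lt_of_limsup_lt ((hFD u).trans_lt hc) (hbdd u)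

/-! ### Mean values of limits in mean of periodic functions -/

/-- The function `f` is approximable in mean by periodic functions. -/
def PeriodicInMean (f : ℕ → ℝ) : Prop :=
  ∀ ε > 0, ∃ q : ℕ, 0 < q ∧ ∃ h : ℕ → ℝ, Function.Periodic h q ∧
    ∃ C : ℝ, ∀ n : ℕ, ∑ i ∈ Finset.range n, |f i - h i| ≤ ε * n + C

/-- Every window of length `q` has the same sum `S`, so the discrepancy from slope `S / q` is itself
`q`-periodic, hence bounded. -/
theorem Function.Periodic.exists_abs_sum_range_sub_le {h : ℕ → ℝ} {q : ℕ} (hq : 0 < q)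
    (hh : Function.Periodic h q) :
    ∃ m C : ℝ, ∀ n : ℕ, |∑ i ∈ Finset.range n, h i - m * n| ≤ C := by
  set S := ∑ i ∈ Finset.range q, h i with hS
  have hwin (n : ℕ) : ∑ i ∈ Finset.range (n + q), h i = ∑ i ∈ Finset.range n, h i + S := by
    induction n with
    | zero => simp [hS]
    | succ n ih =>
      rw [Nat.add_right_comm, Finset.sum_range_succ, ih, hh n, Finset.sum_range_succ]
      ring
  set G : ℕ → ℝ := fun n => |∑ i ∈ Finset.range n, h i - S / q * n| with hG
  have hq' : (q : ℝ) ≠ 0 := by positivity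
  have hper : Function.Periodic G q := by
    intro n
    simp only [hG, hwin]
    congr 1
    push_cast
    field_simp
    ring
  refine ⟨S / q, ∑ i ∈ Finset.range q, G i, fun n => ?_⟩
  change G n ≤ _
  rw [← hper.map_mod_nat n]
  exact Finset.single_le_sum (f := G) (fun i _ => abs_nonneg _)
    (Finset.mem_range.2 (Nat.mod_lt n hq))

theorem tendsto_mul_add_div_atTop (ε C : ℝ) :
    Tendsto (fun n : ℕ => (ε * n + C) / n) atTop (𝓝 ε) := by
  have h := (tendsto_const_div_atTop_nhds_zero_nat C).const_add ε
  rw [add_zero] at h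
  refine h.congr' ?_
  filter_upwards [eventually_gt_atTop 0] with n hn
  have : (n : ℝ) ≠ 0 := by positivity
  field_simp

namespace PeriodicInMean

variable {f g : ℕ → ℝ}

theorem exists_tendsto (hf : PeriodicInMean f) :
    ∃ m : ℝ, Tendsto (fun n : ℕ => (∑ i ∈ Finset.range n, f i) / n) atTop (𝓝 m) := by
  refine cauchySeq_tendsto_of_complete (Metric.cauchySeq_iff'.2 fun ε hε => ?_)
  obtain ⟨q, hq, h, hh, C, hC⟩ := hf (ε / 4) (by positivity)
  obtain ⟨m, C', hm⟩ := hh.exists_abs_sum_range_sub_le hq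
  have hclose : ∀ᶠ n : ℕ in atTop, |(∑ i ∈ Finset.range n, f i) / n - m| < ε / 2 := by
    have := (tendsto_mul_add_div_atTop (ε / 4) (C + C')).eventually
      (gt_mem_nhds (show ε / 4 < ε / 2 by linarith))
    filter_upwards [this, eventually_gt_atTop 0] with n hn hn0
    have hn0' : (0 : ℝ) < n := by positivity
    refine lt_of_le_of_lt ?_ hn
    rw [div_sub' hn0'.ne', abs_div, abs_of_pos hn0']
    gcongr
    have h1 : |∑ i ∈ Finset.range n, f i - ∑ i ∈ Finset.range n, h i| ≤ ε / 4 * n + C := by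
      rw [← Finset.sum_sub_distrib]
      exact (Finset.abs_sum_le_sum_abs _ _).trans (hC n)
    have h2 := hm n
    rw [mul_comm] at h2
    have h3 := abs_sub_le (∑ i ∈ Finset.range n, f i) (∑ i ∈ Finset.range n, h i) (n * m)
    linarith
  obtain ⟨n₀, hn₀⟩ := eventually_atTop.1 hclose
  refine ⟨n₀, fun n hn => ?_⟩
  have h1 := hn₀ n hn
  have h2 := hn₀ n₀ le_rfl
  have h3 := abs_sub_le ((∑ i ∈ Finset.range n, f i) / n) m ((∑ i ∈ Finset.range n₀, f i) / n₀)
  rw [abs_sub_comm m] at h3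
  rw [Real.dist_eq]
  linarith

theorem lipschitz_comp (hf : PeriodicInMean f) {φ : ℝ → ℝ} {c : ℝ} (hc : 0 < c)
    (hφ : ∀ s t, |φ s - φ t| ≤ c * |s - t|) : PeriodicInMean fun n => φ (f n) := by
  intro ε hε
  obtain ⟨q, hq, h, hh, C, hC⟩ := hf (ε / c) (by positivity)
  refine ⟨q, hq, fun n => φ (h n), fun n => by simp only [hh n], c * C, fun n => ?_⟩
  calc ∑ i ∈ Finset.range n, |φ (f i) - φ (h i)|
      ≤ ∑ i ∈ Finset.range n, c * |f i - h i| := Finset.sum_le_sum fun i _ => hφ _ _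
    _ = c * ∑ i ∈ Finset.range n, |f i - h i| := by rw [Finset.mul_sum]
    _ ≤ c * (ε / c * n + C) := by gcongr; exact hC n
    _ = ε * n + c * C := by field_simp

theorem zero : PeriodicInMean fun _ => 0 := fun ε hε =>
  ⟨1, one_pos, fun _ => 0, fun _ => rfl, 0, fun n => by simp; positivity⟩

theorem add (hf : PeriodicInMean f) (hg : PeriodicInMean g) :
    PeriodicInMean fun n => f n + g n := by
  intro ε hε
  obtain ⟨q, hq, h, hh, C, hC⟩ := hf (ε / 2) (by positivity)
  obtain ⟨r, hr, k, hk, C', hC'⟩ := hg (ε / 2) (by positivity)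
  refine ⟨q * r, Nat.mul_pos hq hr, fun n => h n + k n, ?_, C + C', fun n => ?_⟩
  · refine Function.Periodic.add ?_ ?_
    · rw [mul_comm]; exact hh.nat_mul r
    · exact hk.nat_mul q
  · calc ∑ i ∈ Finset.range n, |f i + g i - (h i + k i)|
        ≤ ∑ i ∈ Finset.range n, (|f i - h i| + |g i - k i|) :=
          Finset.sum_le_sum fun i _ => by rw [add_sub_add_comm]; exact abs_add_le _ _
      _ = ∑ i ∈ Finset.range n, |f i - h i| + ∑ i ∈ Finset.range n, |g i - k i| :=
          Finset.sum_add_distrib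
      _ ≤ ε * n + (C + C') := by linarith [hC n, hC' n]

theorem finset_sum {ι : Type*} {F : ι → ℕ → ℝ} (s : Finset ι)
    (hF : ∀ i ∈ s, PeriodicInMean (F i)) : PeriodicInMean fun n => ∑ i ∈ s, F i n := by
  classical
  induction s using Finset.induction_on with
  | empty => simpa using zero
  | insert a s ha ih =>
    simp only [Finset.sum_insert ha]
    exact (hF a (Finset.mem_insert_self a s)).add
      (ih fun i hi => hF i (Finset.mem_insert_of_mem hi))

/-- A limit in mean of functions that are periodic in mean is periodic in mean. -/
theorem of_approx (h : ∀ ε > 0, ∃ g, PeriodicInMean g ∧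
    ∀ n : ℕ, ∑ i ∈ Finset.range n, |f i - g i| ≤ ε * n) : PeriodicInMean f := by
  intro ε hε
  obtain ⟨g, hg, hfg⟩ := h (ε / 2) (by positivity)
  obtain ⟨q, hq, k, hk, C, hC⟩ := hg (ε / 2) (by positivity)
  refine ⟨q, hq, k, hk, C, fun n => ?_⟩
  calc ∑ i ∈ Finset.range n, |f i - k i|
      ≤ ∑ i ∈ Finset.range n, (|f i - g i| + |g i - k i|) :=
        Finset.sum_le_sum fun i _ => abs_sub_le _ _ _
    _ = ∑ i ∈ Finset.range n, |f i - g i| + ∑ i ∈ Finset.range n, |g i - k i| :=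
        Finset.sum_add_distrib
    _ ≤ ε * n + C := by linarith [hC n, hfg n]

/-- One term is at most the whole sum up to it, so a bound on means also controls the series
pointwise. -/
theorem summable_abs_of_mean_le {F : ℕ → ℕ → ℝ} {c : ℕ → ℝ} (hc : Summable c)
    (hFc : ∀ p n : ℕ, ∑ i ∈ Finset.range n, |F p i| ≤ c p * n) (i : ℕ) :
    Summable fun p => |F p i| := by
  refine Summable.of_nonneg_of_le (fun _ => abs_nonneg _) (fun p => ?_)
    (hc.mul_right ((i + 1 : ℕ) : ℝ))
  exact (Finset.single_le_sum (f := fun i => |F p i|) (fun _ _ => abs_nonneg _)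
    (Finset.self_mem_range_succ i)).trans (hFc p (i + 1))

theorem sum_abs_tsum_le {F : ℕ → ℕ → ℝ} {c : ℕ → ℝ} (hc : Summable c)
    (hFc : ∀ p n : ℕ, ∑ i ∈ Finset.range n, |F p i| ≤ c p * n) (n : ℕ) :
    ∑ i ∈ Finset.range n, |∑' p, F p i| ≤ (∑' p, c p) * n := by
  have hs := summable_abs_of_mean_le hc hFc
  calc ∑ i ∈ Finset.range n, |∑' p, F p i|
      ≤ ∑ i ∈ Finset.range n, ∑' p, |F p i| := Finset.sum_le_sum fun i _ => by
        simpa only [Real.norm_eq_abs] using norm_tsum_le_tsum_norm (f := fun p => F p i) (hs i)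
    _ = ∑' p, ∑ i ∈ Finset.range n, |F p i| := (Summable.tsum_finsetSum fun i _ => hs i).symm
    _ ≤ ∑' p, c p * n := (summable_sum fun i _ => hs i).tsum_le_tsum (fun p => hFc p n)
        (hc.mul_right _)
    _ = (∑' p, c p) * n := tsum_mul_right

/-- The tail of the series beyond `y` has mean absolute value at most the tail of `∑ c p`. -/
theorem tsum {F : ℕ → ℕ → ℝ} {c : ℕ → ℝ} (hF : ∀ p, PeriodicInMean (F p)) (hc : Summable c)
    (hFc : ∀ p n : ℕ, ∑ i ∈ Finset.range n, |F p i| ≤ c p * n) :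
    PeriodicInMean fun i => ∑' p, F p i := by
  refine of_approx fun ε hε => ?_
  obtain ⟨y, hy⟩ := ((tendsto_sum_nat_add c).eventually (gt_mem_nhds hε)).exists
  refine ⟨_, finset_sum (Finset.range y) fun p _ => hF p, fun n => ?_⟩
  have h := sum_abs_tsum_le ((summable_nat_add_iff y).2 hc) (fun p n => hFc (p + y) n) n
  refine le_trans (le_of_eq (Finset.sum_congr rfl fun i _ => ?_))
    (h.trans (mul_le_mul_of_nonneg_right hy.le n.cast_nonneg))
  rw [← (summable_abs_of_mean_le hc hFc i).of_abs.sum_add_tsum_nat_add y, add_sub_cancel_left]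

end PeriodicInMean

/-! ### Size of the local terms -/

/-- The local factor of `K*(N)` at a prime `p`. -/
noncomputable def starFactor (p N : ℕ) : ℝ :=
  if p ∣ N then (1 - 1 / ((p : ℝ) ^ padicValNat p N * ((p : ℝ) - 1))) * ((p : ℝ) / ((p : ℝ) - 1))
  else localFactor N p

/-- The contribution of `p` to `log K*(N)`. -/
noncomputable def logStarFactor (p N : ℕ) : ℝ :=
  if p.Prime ∧ N ≠ 0 then Real.log (starFactor p N) else 0

theorem abs_log_one_sub_le {t : ℝ} (h0 : 0 ≤ t) (h1 : t ≤ 1 / 2) : |Real.log (1 - t)| ≤ 2 * t := by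
  have hp : 0 < 1 - t := by linarith
  have h := Real.one_sub_inv_le_log_of_pos hp
  have h' : (1 - t)⁻¹ ≤ 1 + 2 * t := by
    rw [inv_le_iff_one_le_mul₀ hp]
    nlinarith
  rw [abs_of_nonpos (Real.log_nonpos hp.le (by linarith))]
  linarith

theorem localFactor_eq_one_sub {p N : ℕ} (hp : p.Prime) (hpN : ¬ p ∣ N) :
    ∃ t : ℝ, localFactor N p = 1 - t ∧ 0 ≤ t ∧ t ≤ 1 / 2 ∧ t ≤ 4 / (p : ℝ) ^ 2 := by
  refine ⟨_, rfl, ?_⟩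
  rcases hp.eq_two_or_odd' with rfl | hodd
  -- Here `N` is odd, so `N - 1` is even and the symbol vanishes, giving `t = 1/3`. A symbol `±1`
  -- would make the factor zero.
  · have hk : kroneckerAtPrime ((N : ℤ) - 1) ((2 : ℕ)) = 0 := by
      rw [kroneckerAtPrime, if_pos rfl, ZMod.χ₈_int_eq_if_mod_eight, if_pos (by omega)]
    rw [hk]
    norm_num
  · have hp3 : (3 : ℝ) ≤ (p : ℝ) := by
      have := hp.two_le
      obtain ⟨m, rfl⟩ := hodd
      exact_mod_cast (by omega : 3 ≤ 2 * m + 1)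
    have hk0 := sq_nonneg (kroneckerAtPrime ((N : ℤ) - 1) p : ℝ)
    have hk : ((kroneckerAtPrime ((N : ℤ) - 1) p : ℝ)) ^ 2 ≤ 1 := by
      exact_mod_cast kroneckerAtPrime_sq_le_one _ _
    generalize (p : ℝ) = q at *
    generalize ((kroneckerAtPrime ((N : ℤ) - 1) p : ℝ)) ^ 2 = k at *
    have hq1 : 0 < q - 1 := by linarith
    have hle : (k * q + 1) / ((q - 1) ^ 2 * (q + 1)) ≤ 1 / (q - 1) ^ 2 := by
      rw [div_le_div_iff₀ (by positivity) (by positivity)]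
      have : k * q + 1 ≤ q + 1 := by nlinarith
      calc (k * q + 1) * (q - 1) ^ 2 ≤ (q + 1) * (q - 1) ^ 2 := by gcongr
        _ = 1 * ((q - 1) ^ 2 * (q + 1)) := by ring
    refine ⟨by positivity, hle.trans ?_, hle.trans ?_⟩
    · rw [div_le_div_iff₀ (by positivity) (by positivity)]
      nlinarith
    · rw [div_le_div_iff₀ (by positivity) (by positivity)]
      nlinarith

theorem starFactor_factors {p N : ℕ} (hp : p.Prime) (hN : N ≠ 0) (hpN : p ∣ N) :
    ∃ t : ℝ, 1 / ((p : ℝ) ^ padicValNat p N * ((p : ℝ) - 1)) = t ∧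
      0 ≤ t ∧ t ≤ 1 / 2 ∧ t ≤ 1 / (p : ℝ) := by
  refine ⟨_, rfl, ?_⟩
  have := Fact.mk hp
  have hp2 : (2 : ℝ) ≤ p := by exact_mod_cast hp.two_le
  have hpow : (p : ℝ) ≤ (p : ℝ) ^ padicValNat p N :=
    le_self_pow₀ (by linarith) (Nat.one_le_iff_ne_zero.1 (one_le_padicValNat_of_dvd hN hpN))
  have hle : 1 / ((p : ℝ) ^ padicValNat p N * ((p : ℝ) - 1)) ≤ 1 / p := by
    apply one_div_le_one_div_of_le (by linarith)
    nlinarith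
  exact ⟨one_div_nonneg.2 (mul_nonneg (by positivity) (by linarith)),
    hle.trans (one_div_le_one_div_of_le two_pos hp2), hle⟩

theorem localFactor_pos {p N : ℕ} (hp : p.Prime) (hpN : ¬ p ∣ N) : 0 < localFactor N p := by
  obtain ⟨t, ht, -, h, -⟩ := localFactor_eq_one_sub hp hpN
  rw [ht]
  linarith

theorem starFactor_pos {p N : ℕ} (hp : p.Prime) (hN : N ≠ 0) : 0 < starFactor p N := by
  rw [starFactor]
  split_ifs with hpN
  · obtain ⟨t, ht, -, h, -⟩ := starFactor_factors hp hN hpN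
    have hp2 : (2 : ℝ) ≤ p := by exact_mod_cast hp.two_le
    rw [ht]
    exact mul_pos (by linarith) (div_pos (by linarith) (by linarith))
  · exact localFactor_pos hp hpN

theorem abs_logStarFactor_le (p N : ℕ) :
    |logStarFactor p N| ≤ 8 / (p : ℝ) ^ 2 + if N ≠ 0 ∧ p ∣ N then 4 / (p : ℝ) else 0 := by
  rw [logStarFactor]
  split_ifs with h1 h2 h2
  · obtain ⟨hp, hN⟩ := h1
    obtain ⟨t, ht, h0, h, h'⟩ := starFactor_factors hp hN h2.2
    have hp2 : (2 : ℝ) ≤ p := by exact_mod_cast hp.two_le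
    rw [starFactor, if_pos h2.2, ht, Real.log_mul (by linarith)
      (div_pos (by linarith) (by linarith)).ne']
    have hr : (p : ℝ) / (p - 1) = 1 + 1 / (p - 1) := by
      have : (p : ℝ) - 1 ≠ 0 := by linarith
      field_simp
      ring
    have hd : 1 / ((p : ℝ) - 1) ≤ 2 / p := by
      rw [div_le_div_iff₀ (by linarith) (by linarith)]
      linarith
    have hr0 : 0 ≤ 1 / ((p : ℝ) - 1) := one_div_nonneg.2 (by linarith)
    have hlog : |Real.log ((p : ℝ) / (p - 1))| ≤ 2 / p := by
      rw [abs_of_nonneg (Real.log_nonneg (by rw [hr]; linarith))]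
      have := Real.log_le_sub_one_of_pos (show 0 < (p : ℝ) / (p - 1) by rw [hr]; linarith)
      linarith
    have h8 : 0 ≤ 8 / (p : ℝ) ^ 2 := by positivity
    have h4 : 4 / (p : ℝ) = 2 * (1 / p) + 2 / p := by ring
    have := abs_log_one_sub_le h0 h
    linarith [abs_add_le (Real.log (1 - t)) (Real.log ((p : ℝ) / (p - 1)))]
  · obtain ⟨hp, hN⟩ := h1
    have hpN : ¬ p ∣ N := fun h => h2 ⟨hN, h⟩
    obtain ⟨t, ht, h0, h, h'⟩ := localFactor_eq_one_sub hp hpN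
    rw [starFactor, if_neg hpN, ht, add_zero]
    have h8 : 8 / (p : ℝ) ^ 2 = 2 * (4 / (p : ℝ) ^ 2) := by ring
    linarith [abs_log_one_sub_le h0 h]
  · rw [abs_zero]; positivity
  · rw [abs_zero]; positivity

/-- Leaving out `0` avoids an additive constant, which could not be summed over all primes. -/
theorem card_multiples_range_le (d n : ℕ) :
    ((Finset.range n).filter fun i => i ≠ 0 ∧ d ∣ i).card ≤ n / d := by
  rw [← Nat.card_multiples' n d]
  exact Finset.card_le_card (Finset.filter_subset_filter _ (Finset.range_mono n.le_succ))

theorem sum_range_ite_dvd_le (d n : ℕ) {b : ℝ} (hb : 0 ≤ b) :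
    (∑ i ∈ Finset.range n, if i ≠ 0 ∧ d ∣ i then b else 0) ≤ b * (n / d) := by
  rw [← Finset.sum_filter, Finset.sum_const, nsmul_eq_mul, mul_comm]
  gcongr
  exact (Nat.cast_le.2 (card_multiples_range_le d n)).trans Nat.cast_div_le

theorem sum_abs_logStarFactor_le (p n : ℕ) :
    ∑ i ∈ Finset.range n, |logStarFactor p i| ≤ 12 * (1 / (p : ℝ) ^ 2) * n := by
  calc ∑ i ∈ Finset.range n, |logStarFactor p i|
      ≤ ∑ i ∈ Finset.range n, (8 / (p : ℝ) ^ 2 + if i ≠ 0 ∧ p ∣ i then 4 / (p : ℝ) else 0) :=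
        Finset.sum_le_sum fun i _ => abs_logStarFactor_le p i
    _ ≤ n * (8 / (p : ℝ) ^ 2) + 4 / p * (n / p) := by
        rw [Finset.sum_add_distrib, Finset.sum_const, Finset.card_range, nsmul_eq_mul]
        gcongr
        exact sum_range_ite_dvd_le p n (by positivity)
    _ = 12 * (1 / (p : ℝ) ^ 2) * n := by ring

/-! ### Near-periodicity of the local terms -/

theorem kroneckerAtPrime_congr {p k : ℕ} (hk : 3 ≤ k) {a b : ℤ}
    (h : a ≡ b [ZMOD ((p ^ k : ℕ) : ℤ)]) : kroneckerAtPrime a p = kroneckerAtPrime b p := by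
  rw [kroneckerAtPrime, kroneckerAtPrime]
  split_ifs with hp
  · subst hp
    -- The symbol at 2 has period 8, whence `3 ≤ k`.
    have h8 : a ≡ b [ZMOD ((8 : ℕ) : ℤ)] :=
      h.of_dvd (Int.natCast_dvd_natCast.2 (pow_dvd_pow 2 hk))
    rw [(ZMod.intCast_eq_intCast_iff a b 8).2 h8]
  · have hp' : a ≡ b [ZMOD (p : ℤ)] :=
      h.of_dvd (Int.natCast_dvd_natCast.2 (dvd_pow_self p (by omega)))
    rw [jacobiSym.mod_left a, jacobiSym.mod_left b, hp'.eq]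

theorem padicValNat_mod_pow {p k N : ℕ} (hp : p.Prime) (h : ¬ p ^ k ∣ N) :
    padicValNat p (N % p ^ k) = padicValNat p N := by
  have := Fact.mk hp
  have h' : ¬ p ^ k ∣ N % p ^ k := fun hd => h ((Nat.dvd_mod_iff dvd_rfl).1 hd)
  have hN : N ≠ 0 := by rintro rfl; simp at h
  have hN' : N % p ^ k ≠ 0 := by intro h0; simp [h0] at h'
  refine eq_of_forall_le_iff fun j => ?_
  rw [← padicValNat_dvd_iff_le hN', ← padicValNat_dvd_iff_le hN]
  rcases le_total j k with hj | hj
  · exact Nat.dvd_mod_iff (pow_dvd_pow p hj)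
  · exact iff_of_false (fun hd => h' ((pow_dvd_pow p hj).trans hd))
      (fun hd => h ((pow_dvd_pow p hj).trans hd))

theorem logStarFactor_mod_pow {p k N : ℕ} (hk : 3 ≤ k) (h : ¬ p ^ k ∣ N) :
    logStarFactor p (N % p ^ k) = logStarFactor p N := by
  by_cases hp : p.Prime
  · have hN : N ≠ 0 := by rintro rfl; simp at h
    have hN' : N % p ^ k ≠ 0 := fun h0 => h (Nat.dvd_of_mod_eq_zero h0)
    have hmod : ((N % p ^ k : ℕ) : ℤ) - 1 ≡ (N : ℤ) - 1 [ZMOD ((p ^ k : ℕ) : ℤ)] := by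
      refine Int.ModEq.sub_right 1 ?_
      rw [Int.natCast_modEq_iff]
      exact Nat.mod_modEq N _
    rw [logStarFactor, logStarFactor, if_pos ⟨hp, hN'⟩, if_pos ⟨hp, hN⟩, starFactor, starFactor,
      padicValNat_mod_pow hp h, localFactor, localFactor, kroneckerAtPrime_congr hk hmod]
    simp only [Nat.dvd_mod_iff (dvd_pow_self p (show k ≠ 0 by omega))]
  · simp [logStarFactor, hp]

theorem abs_logStarFactor_le_twelve (p N : ℕ) : |logStarFactor p N| ≤ 12 := by
  rcases Nat.eq_zero_or_pos p with rfl | hp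
  · simp [logStarFactor, Nat.not_prime_zero]
  · have h1 : (1 : ℝ) ≤ p := by exact_mod_cast hp
    have h8 : 8 / (p : ℝ) ^ 2 ≤ 8 := div_le_self (by norm_num) (one_le_pow₀ h1)
    have h4 : 4 / (p : ℝ) ≤ 4 := div_le_self (by norm_num) h1
    have := abs_logStarFactor_le p N
    split_ifs at this <;> linarith

/-- Reduction modulo `p ^ k` changes the term only on multiples of `p ^ k`, by at most `24 = 2 *
12`; their density `p ^ (-k)` can be made small. -/
theorem periodicInMean_logStarFactor (p : ℕ) : PeriodicInMean (logStarFactor p) := by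
  by_cases hp : p.Prime
  swap
  · have : logStarFactor p = fun _ => 0 := by ext N; simp [logStarFactor, hp]
    rw [this]
    exact .zero
  intro ε hε
  have hlt : ∀ᶠ k : ℕ in atTop, 24 / ε < (p : ℝ) ^ k :=
    (tendsto_pow_atTop_atTop_of_one_lt (by exact_mod_cast hp.one_lt)).eventually_gt_atTop _
  obtain ⟨k, hkε, hk⟩ := (hlt.and (eventually_ge_atTop 3)).exists
  have hpk : (0 : ℝ) < (p : ℝ) ^ k := pow_pos (by exact_mod_cast hp.pos) k
  refine ⟨p ^ k, pow_pos hp.pos k, fun N => logStarFactor p (N % p ^ k), fun N => by simp, 0,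
    fun n => ?_⟩
  calc ∑ i ∈ Finset.range n, |logStarFactor p i - logStarFactor p (i % p ^ k)|
      ≤ ∑ i ∈ Finset.range n, if i ≠ 0 ∧ p ^ k ∣ i then (24 : ℝ) else 0 := by
        refine Finset.sum_le_sum fun i _ => ?_
        split_ifs with h
        · have := abs_sub (logStarFactor p i) (logStarFactor p (i % p ^ k))
          linarith [abs_logStarFactor_le_twelve p i,
            abs_logStarFactor_le_twelve p (i % p ^ k)]
        · rcases eq_or_ne i 0 with rfl | hi
          · simp
          · rw [logStarFactor_mod_pow hk fun hd => h ⟨hi, hd⟩, sub_self, abs_zero]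
    _ ≤ 24 * (n / (p ^ k : ℕ)) := sum_range_ite_dvd_le _ n (by norm_num)
    _ = 24 / (p : ℝ) ^ k * n := by push_cast; ring
    _ ≤ ε * n + 0 := by
        rw [add_zero]
        gcongr
        rw [div_le_iff₀ hpk]
        rw [div_lt_iff₀ hε] at hkε
        linarith

/-! ### The logarithm of `K*` as a sum over primes -/

theorem summable_twelve_div_sq : Summable fun p : ℕ => 12 * (1 / (p : ℝ) ^ 2) :=
  (Real.summable_one_div_nat_pow.2 one_lt_two).mul_left 12

theorem summable_logStarFactor (N : ℕ) : Summable fun p => logStarFactor p N :=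
  (PeriodicInMean.summable_abs_of_mean_le summable_twelve_div_sq sum_abs_logStarFactor_le N).of_abs

theorem div_totient_eq_prod {N : ℕ} (hN : N ≠ 0) :
    (N : ℝ) / (Nat.totient N : ℝ) = ∏ p ∈ N.primeFactors, (p : ℝ) / ((p : ℝ) - 1) := by
  have h : (Nat.totient N : ℝ) = N * ∏ p ∈ N.primeFactors, (1 - (p : ℝ)⁻¹) := by
    have h := congrArg (fun x : ℚ => (x : ℝ)) (Nat.totient_eq_mul_prod_factors N)
    push_cast at h
    exact h
  have hN' : (N : ℝ) ≠ 0 := Nat.cast_ne_zero.2 hN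
  rw [h, ← div_div, div_self hN', one_div, ← Finset.prod_inv_distrib]
  refine Finset.prod_congr rfl fun p hp => ?_
  have hp0 : (p : ℝ) ≠ 0 := Nat.cast_ne_zero.2 (Nat.prime_of_mem_primeFactors hp).ne_zero
  rw [← inv_div, sub_div, div_self hp0, one_div]

theorem Kstar_eq_exp_tsum {N : ℕ} (hN : N ≠ 0) :
    Kstar N = Real.exp (∑' p, logStarFactor p N) := by
  set s : Set ℕ := {p | p.Prime ∧ ¬ p ∣ N} with hs
  have hsplit := (summable_logStarFactor N).tsum_subtype_add_tsum_subtype_compl s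
  have h1 : Real.exp (∑' p : s, logStarFactor p N) = ∏' p : s, localFactor N p := by
    have hlog (p : s) : logStarFactor p N = Real.log (localFactor N p) := by
      rw [logStarFactor, if_pos ⟨p.2.1, hN⟩, starFactor, if_neg p.2.2]
    simp only [hlog]
    refine Real.rexp_tsum_eq_tprod (fun p : s => localFactor_pos p.2.1 p.2.2) ?_
    simp only [← hlog]
    exact (summable_logStarFactor N).subtype s
  have h2 : ∑' p : (sᶜ : Set ℕ), logStarFactor p N
      = ∑ p ∈ N.primeFactors, Real.log (starFactor p N) := by
    rw [tsum_subtype (sᶜ : Set ℕ) fun p => logStarFactor p N]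
    rw [tsum_eq_sum (s := N.primeFactors)]
    · refine Finset.sum_congr rfl fun p hp => ?_
      have hp' := Nat.mem_primeFactors.1 hp
      rw [Set.indicator_of_mem (by simp [hs, hp'.2.1]), logStarFactor, if_pos ⟨hp'.1, hN⟩]
    · intro p hp
      rw [Set.indicator_apply_eq_zero]
      intro hps
      rw [logStarFactor, if_neg]
      rintro ⟨hpr, -⟩
      exact hps ⟨hpr, fun hd => hp (Nat.mem_primeFactors.2 ⟨hpr, hd, hN⟩)⟩
  have h3 : Real.exp (∑ p ∈ N.primeFactors, Real.log (starFactor p N))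
      = ∏ p ∈ N.primeFactors, ((1 - 1 / ((p : ℝ) ^ padicValNat p N * ((p : ℝ) - 1))) *
        ((p : ℝ) / ((p : ℝ) - 1))) := by
    rw [Real.exp_sum]
    refine Finset.prod_congr rfl fun p hp => ?_
    have hp' := Nat.mem_primeFactors.1 hp
    rw [Real.exp_log (starFactor_pos hp'.1 hN), starFactor, if_pos hp'.2.1]
  rw [← hsplit, Real.exp_add, h1, h2, h3, Finset.prod_mul_distrib, ← div_totient_eq_prod hN,
    Kstar, K, mul_div_assoc, mul_assoc]
  rfl

theorem periodicInMean_tsum_logStarFactor : PeriodicInMean fun N => ∑' p, logStarFactor p N :=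
  .tsum periodicInMean_logStarFactor summable_twelve_div_sq sum_abs_logStarFactor_le

/-! ### Averages up to a real bound -/

theorem PeriodicInMean.exists_tendsto_sum_Icc_floor {f : ℕ → ℝ} (hf : PeriodicInMean f) :
    ∃ m : ℝ, Tendsto (fun x : ℝ => 1 / x * ∑ N ∈ Finset.Icc 1 ⌊x⌋₊, f N) atTop (𝓝 m) := by
  obtain ⟨m, hm⟩ := hf.exists_tendsto
  refine ⟨m, ?_⟩
  have h1 : Tendsto (fun x : ℝ => ⌊x⌋₊ + 1) atTop atTop :=
    (tendsto_add_atTop_nat 1).comp tendsto_nat_floor_atTop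
  have h2 : Tendsto (fun x : ℝ => ((⌊x⌋₊ + 1 : ℕ) : ℝ) / x) atTop (𝓝 1) := by
    have h := (tendsto_nat_floor_div_atTop (R := ℝ)).add (tendsto_inv_atTop_zero (𝕜 := ℝ))
    rw [add_zero] at h
    refine h.congr fun x => ?_
    push_cast
    rw [add_div, one_div]
  have h3 := ((hm.comp h1).mul h2).sub ((tendsto_inv_atTop_zero (𝕜 := ℝ)).mul_const (f 0))
  rw [mul_one, zero_mul, sub_zero] at h3
  refine h3.congr' ?_
  filter_upwards [eventually_gt_atTop 0] with x hx
  have hne : ((⌊x⌋₊ + 1 : ℕ) : ℝ) ≠ 0 := by positivity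
  have hsum : ∑ i ∈ Finset.range (⌊x⌋₊ + 1), f i = f 0 + ∑ N ∈ Finset.Icc 1 ⌊x⌋₊, f N := by
    rw [Finset.range_eq_Ico, Finset.sum_eq_sum_Ico_succ_bot (by omega)]
    rfl
  simp only [Function.comp_apply]
  rw [hsum]
  field_simp
  ring

theorem ncard_Kstar_le (u x : ℝ) :
    ({N : ℕ | 1 ≤ N ∧ (N : ℝ) ≤ x ∧ Kstar N ≤ u}.ncard : ℝ)
      = ∑ N ∈ Finset.Icc 1 ⌊x⌋₊, if Kstar N ≤ u then (1 : ℝ) else 0 := by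
  have h : {N : ℕ | 1 ≤ N ∧ (N : ℝ) ≤ x ∧ Kstar N ≤ u}
      = ((Finset.Icc 1 ⌊x⌋₊).filter fun N => Kstar N ≤ u : Finset ℕ) := by
    ext N
    simp only [Set.mem_ofPred_eq, Finset.coe_filter, Finset.mem_Icc, and_assoc]
    refine and_congr_right fun hN => and_congr_left fun _ => ?_
    rw [Nat.le_floor_iff' (by omega)]
  rw [h, Set.ncard_coe_finset, Finset.sum_boole]

theorem Kstar_pos {N : ℕ} (hN : N ≠ 0) : 0 < Kstar N := by
  rw [Kstar_eq_exp_tsum hN]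
  exact Real.exp_pos _

theorem Kstar_le_iff {N : ℕ} (hN : N ≠ 0) {u : ℝ} (hu : 0 < u) :
    Kstar N ≤ u ↔ ∑' p, logStarFactor p N ≤ Real.log u := by
  rw [Kstar_eq_exp_tsum hN, Real.le_log_iff_exp_le hu]

theorem one_div_mul_sum_Icc_floor_mono {f g : ℕ → ℝ} (h : ∀ N, N ≠ 0 → f N ≤ g N) (x : ℝ) :
    1 / x * ∑ N ∈ Finset.Icc 1 ⌊x⌋₊, f N ≤ 1 / x * ∑ N ∈ Finset.Icc 1 ⌊x⌋₊, g N := by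
  -- For `x < 1` both sums are empty, so a negative `1 / x` does no harm.
  rcases le_total x 1 with hx | hx
  · rcases hx.lt_or_eq with hx | rfl
    · simp [Nat.floor_eq_zero.2 hx]
    · simpa using h 1 one_ne_zero
  · gcongr with N hN
    exact h N (Nat.one_le_iff_ne_zero.1 (Finset.mem_Icc.1 hN).1)

theorem one_div_mul_sum_Icc_floor_one_le (x : ℝ) :
    1 / x * ∑ _N ∈ Finset.Icc 1 ⌊x⌋₊, (1 : ℝ) ≤ 1 := by
  rcases le_or_gt x 0 with hx | hx
  · simp [Nat.floor_of_nonpos hx]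
  · rw [Finset.sum_const, Nat.card_Icc, nsmul_eq_mul, mul_one, Nat.add_sub_cancel,
      one_div_mul_eq_div, div_le_one hx]
    exact Nat.floor_le hx.le

/-! ### Tightness, separation and conclusion -/

/-- The piecewise linear function equal to `1` on `(-∞, α]` and to `0` on `[β, ∞)`. -/
noncomputable def ramp (α β t : ℝ) : ℝ := max 0 (min 1 ((β - t) / (β - α)))

theorem ramp_lipschitz {α β : ℝ} (h : α < β) (s t : ℝ) :
    |ramp α β s - ramp α β t| ≤ 1 / (β - α) * |s - t| := by
  have h' : 0 < β - α := sub_pos.2 h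
  refine (abs_max_sub_max_le_max _ _ _ _).trans ?_
  rw [sub_self, abs_zero, max_eq_right (abs_nonneg _)]
  refine (abs_min_sub_min_le_max _ _ _ _).trans ?_
  rw [sub_self, abs_zero, max_eq_right (abs_nonneg _), ← sub_div, abs_div, abs_of_pos h',
    sub_sub_sub_cancel_left, abs_sub_comm, one_div_mul_eq_div]

theorem ite_le_ramp {α β : ℝ} (h : α < β) (t : ℝ) :
    (if t ≤ α then (1 : ℝ) else 0) ≤ ramp α β t := by
  have h' : 0 < β - α := sub_pos.2 h
  split_ifs with ht
  · exact le_max_of_le_right (le_min le_rfl ((one_le_div h').2 (by linarith)))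
  · exact le_max_left _ _

theorem ramp_le_ite {α β : ℝ} (h : α < β) (t : ℝ) :
    ramp α β t ≤ if t ≤ β then (1 : ℝ) else 0 := by
  have h' : 0 < β - α := sub_pos.2 h
  split_ifs with ht
  · exact max_le zero_le_one (min_le_left _ _)
  · exact max_le le_rfl (min_le_of_right_le (div_nonpos_of_nonpos_of_nonneg (by linarith) h'.le))

/-- Markov's inequality for `|log K*|`, whose mean is bounded by `C`. -/
theorem eventually_one_sub_le_freq_Kstar {ε : ℝ} (hε : 0 < ε) :
    ∃ u : ℝ, ∀ᶠ x : ℝ in atTop,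
      1 - ε ≤ 1 / x * ∑ N ∈ Finset.Icc 1 ⌊x⌋₊, if Kstar N ≤ u then (1 : ℝ) else 0 := by
  set C : ℝ := ∑' p : ℕ, 12 * (1 / (p : ℝ) ^ 2) with hC
  have hC0 : 0 ≤ C := tsum_nonneg fun p => by positivity
  have hmean := PeriodicInMean.sum_abs_tsum_le summable_twelve_div_sq sum_abs_logStarFactor_le
  -- With `x + 1 ≤ 2 * x` this makes the Markov loss at most `ε / 2 * x`; rounding `x` down costs at
  -- most `ε / 4 * x` once `x ≥ 4 / ε`.
  set T : ℝ := 4 * (C + 1) / ε with hT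
  have hT0 : 0 < T := by positivity
  refine ⟨Real.exp T, ?_⟩
  filter_upwards [eventually_ge_atTop 1, eventually_ge_atTop (4 / ε)] with x hx1 hxε
  have hx0 : 0 < x := by linarith
  have hfl := Nat.floor_le hx0.le
  have hfl' := Nat.lt_floor_add_one x
  have hL : ∑ N ∈ Finset.Icc 1 ⌊x⌋₊, |∑' p, logStarFactor p N| ≤ C * (x + 1) := by
    refine (Finset.sum_le_sum_of_subset_of_nonneg (t := Finset.range (⌊x⌋₊ + 1)) ?_
      fun _ _ _ => abs_nonneg _).trans ((hmean (⌊x⌋₊ + 1)).trans ?_)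
    · intro N hN
      have := (Finset.mem_Icc.1 hN).2
      exact Finset.mem_range.2 (by omega)
    · push_cast
      gcongr
  have hpt : ∑ N ∈ Finset.Icc 1 ⌊x⌋₊, (1 - |∑' p, logStarFactor p N| / T)
      ≤ ∑ N ∈ Finset.Icc 1 ⌊x⌋₊, if Kstar N ≤ Real.exp T then (1 : ℝ) else 0 := by
    refine Finset.sum_le_sum fun N hN => ?_
    have hN0 : N ≠ 0 := Nat.one_le_iff_ne_zero.1 (Finset.mem_Icc.1 hN).1
    split_ifs with h
    · have : 0 ≤ |∑' p, logStarFactor p N| / T := by positivity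
      linarith
    · rw [Kstar_le_iff hN0 (Real.exp_pos T), Real.log_exp, not_le] at h
      have : 1 ≤ |∑' p, logStarFactor p N| / T :=
        (one_le_div hT0).2 (h.le.trans (le_abs_self _))
      linarith
  rw [Finset.sum_sub_distrib, ← Finset.sum_div, Finset.sum_const, Nat.card_Icc, nsmul_eq_mul,
    mul_one, Nat.add_sub_cancel] at hpt
  have hCT : C * (x + 1) / T ≤ ε / 4 * (2 * x) := by
    rw [div_le_iff₀ hT0, hT]
    calc C * (x + 1) ≤ (C + 1) * (2 * x) := by gcongr <;> linarith
      _ = ε / 4 * (2 * x) * (4 * (C + 1) / ε) := by field_simp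
  have hLT : (∑ N ∈ Finset.Icc 1 ⌊x⌋₊, |∑' p, logStarFactor p N|) / T ≤ C * (x + 1) / T := by
    gcongr
  rw [div_le_iff₀ hε] at hxε
  rw [one_div_mul_eq_div, le_div_iff₀ hx0]
  linarith

theorem exists_separating_freq_Kstar {u v : ℝ} (huv : u < v) :
    ∃ m : ℝ, ∀ ε > 0, ∀ᶠ x : ℝ in atTop,
      (1 / x * ∑ N ∈ Finset.Icc 1 ⌊x⌋₊, if Kstar N ≤ u then (1 : ℝ) else 0) ≤ m + ε ∧
      m - ε ≤ 1 / x * ∑ N ∈ Finset.Icc 1 ⌊x⌋₊, if Kstar N ≤ v then (1 : ℝ) else 0 := by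
  -- For `u ≤ 0` there is no `log u` to use, but `K* > 0` makes the frequency at `u` zero.
  rcases le_or_gt u 0 with hu | hu
  · refine ⟨0, fun ε hε => Eventually.of_forall fun x => ⟨?_, ?_⟩⟩
    · refine (one_div_mul_sum_Icc_floor_mono (g := fun _ => 0) (fun N hN => ?_) x).trans ?_
      · rw [if_neg (hu.trans_lt (Kstar_pos hN)).not_ge]
      · simpa using hε.le
    · refine le_trans ?_ (one_div_mul_sum_Icc_floor_mono (f := fun _ => 0) (fun N hN => ?_) x)
      · simpa using hε.le
      · split_ifs <;> norm_num
  · have hlog := Real.log_lt_log hu huv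
    obtain ⟨m, hm⟩ := (periodicInMean_tsum_logStarFactor.lipschitz_comp
      (one_div_pos.2 (sub_pos.2 hlog)) (ramp_lipschitz hlog)).exists_tendsto_sum_Icc_floor
    refine ⟨m, fun ε hε => ?_⟩
    filter_upwards [hm.eventually (lt_mem_nhds (sub_lt_self m hε)),
      hm.eventually (gt_mem_nhds (lt_add_of_pos_right m hε))] with x hx1 hx2
    refine ⟨(one_div_mul_sum_Icc_floor_mono (fun N hN => ?_) x).trans hx2.le,
      hx1.le.trans (one_div_mul_sum_Icc_floor_mono (fun N hN => ?_) x)⟩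
    · simp only [Kstar_le_iff hN hu]
      exact ite_le_ramp hlog _
    · simp only [Kstar_le_iff hN (hu.trans huv)]
      exact ramp_le_ite hlog _

theorem theorem1p4 :
    ∃ D : ℝ → ℝ, IsDistributionFunction D ∧
      ∀ u : ℝ, ContinuousAt D u →
        Tendsto
          (fun x : ℝ => 1 / x * ({N : ℕ | 1 ≤ N ∧ (N : ℝ) ≤ x ∧ Kstar N ≤ u}.ncard : ℝ))
          atTop (𝓝 (D u)) := by
  simp only [ncard_Kstar_le]
  refine exists_isDistributionFunction_of_separated (fun u x => ?_) (fun u x => ?_)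
    (fun x u v huv => ?_) (fun u v huv => exists_separating_freq_Kstar huv)
    (fun ε hε => ⟨0, Eventually.of_forall fun x => ?_⟩)
    (fun ε hε => eventually_one_sub_le_freq_Kstar hε)
  · refine le_trans ?_ (one_div_mul_sum_Icc_floor_mono (f := fun _ => 0) (fun N hN => ?_) x)
    · simp
    · split_ifs <;> norm_num
  · refine (one_div_mul_sum_Icc_floor_mono (fun N hN => ?_) x).trans
      (one_div_mul_sum_Icc_floor_one_le x)
    split_ifs <;> norm_num
  · refine one_div_mul_sum_Icc_floor_mono (fun N hN => ?_) x
    split_ifs with h1 h2 <;> first | exact absurd (h1.trans huv) h2 | norm_num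
  · refine (one_div_mul_sum_Icc_floor_mono (g := fun _ => 0) (fun N hN => ?_) x).trans ?_
    · rw [if_neg (Kstar_pos hN).not_ge]
    · simpa using hε.le
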